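/- Identify $\mathbb R^2$ with $\mathbb C$, with its Euclidean inner product. For $k\in\{0,1\}$ a pointed $k$-chain is a finite formal sum $\sum_i (p_i;\alpha_i)$ with $p_i\in\mathbb R^2$ and $\alpha_i\in\Lambda^k\mathbb R^2$ (so $\alpha_i\in\mathbb R$ if $k=0$ and $\alpha_i\in\mathbb R^2$ if $k=1$). For $u\in\mathbb R^2$ put $\Delta_u(p;\alpha)=(p+u;\alpha)-(p;\alpha)$, extended linearly, and for $U=(u_1,\dots,u_j)$ put $\Delta_U=\Delta_{u_1}\cdots\Delta_{u_j}$. For an integer $r\ge 0$ the $r$-norm of a pointed chain $A$ is $$\|A\|_{B^r}=\inf\Big\{\sum_{i=1}^N \|u_{i,1}\|\cdots\|u_{i,j_i}\|\,\|\alpha_i\| \;:\; A=\sum_{i=1}^N\Delta_{U_i}(p_i;\alpha_i),\ U_i=(u_{i,1},\dots,u_{i,j_i}),\ 0\le j_i\le r\Big\},$$ and the space $\hat{\mathcal B}^r_k$ of differential $k$-chains of order $r$ is the completion of the pointed $k$-chains in this norm. For $r\ge1$ the boundary $\partial:\hat{\mathcal B}^r_1\to\hat{\mathcal B}^{r+1}_0$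 is the continuous linear map with $$\partial(p;\alpha)=\sum_{i=1}^2\lim_{t\to0}\Delta_{te_i}\big(p;\langle e_i,\alpha\rangle/t\big),$$ where $e_1,e_2$ is the standard basis; $J$ is closed if $\partial J=0$. A closed set $X$ supports $J\in\hat{\mathcal B}^r_k$ if for every non-empty open $W\supseteq X$ the chain $J$ is a limit in $\hat{\mathcal B}^r_k$ of pointed chains supported in $W$; $\operatorname{supp}J$ is the intersection of all closed sets supporting $J$, and $J$ is compactly supported if $\operatorname{supp} J$ is compact. A (complex-valued) $1$-form $\eta$ on $\mathbb R^2$ is of class $\mathcal B^r_1$ if there is $C$ with $|\eta(\Delta_U(p;\alpha))|\le C\|u_1\|\cdots\|u_j\|\|\alpha\|$ for all $p,\alpha$ and all $U=(u_1,\dots,u_j)$ with $0\le j\le r$; its integral over $J\in\hat{\mathcal B}^r_1$ is the value at $J$ of the continuous extension of $\sum(p_i;\alpha_i)\mapsto\sum\eta_{p_i}(\alpha_i)$. For a form $\omega$ given near $\operatorname{supp}J$, $\int_J\omega$ is defined as $\int_J\eta$ for any form $\eta$ of class $\mathcal B_1^r$ on $\mathbb R^2$ that agrees with $\omega$ on an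 open neighbourhood of $\operatorname{supp}J$; it is well defined if such $\eta$ exist and all of them give the same value. For $z\notin\operatorname{supp}J$ the winding number is $$\operatorname{Ind}_J(z)=\frac1{2\pi i}\int_J\frac{dw}{w-z}.$$ **Corollary.** Let $r\ge1$ and let $J\in\hat{\mathcal B}^r_1$ be a closed, compactly supported differential $1$-chain of order $r$ in $\mathbb R^2$. Then for every $z$ in the unbounded connected component of $\mathbb R^2\setminus\operatorname{supp}J$, the integral defining $\operatorname{Ind}_J(z)$ is well defined and $\operatorname{Ind}_J(z)=0$. -/

import Mathlib

open Topology Filter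

set_option linter.unusedSectionVars false

noncomputable section

namespace DiffChain

/-! ## Pointed chains and the `r`-norms

Pointed `k`-chains on `E` are finitely supported sections of `Λ^k TE`.  Only `k = 0` and `k = 1`
occur below, so the fibre is written as a normed space `V`: take `V = ℝ` for `k = 0` and `V = E`
for `k = 1`.  In these degrees every `k`-vector is simple, so the mass norm on the fibre is the
absolute value, respectively the norm of `E`. -/

section Chains

variable {E V : Type*} [NormedAddCommGroup E] [NormedSpace ℝ E]
  [NormedAddCommGroup V] [NormedSpace ℝ V]

/-- Translation `T_u`, sending `∑ (pᵢ; αᵢ)` to `∑ (pᵢ + u; αᵢ)`. -/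
def translate (u : E) : (E →₀ V) →ₗ[ℝ] (E →₀ V) :=
  Finsupp.lmapDomain V ℝ (fun p => p + u)

/-- The difference operator `Δ_u = T_u - Id`. -/
def difference (u : E) : (E →₀ V) →ₗ[ℝ] (E →₀ V) :=
  translate u - LinearMap.id

variable (E V) in
/-- The data `(U, p, α)` of a difference chain `Δ_U^j (p; α)`, where `j` is the length of `U`. -/
structure DifferenceElement where
  /-- the list `U = (u₁, …, u_j)` of directions, possibly with repetitions -/
  dirs : List E
  /-- the base point `p` -/
  pt : E
  /-- the `k`-vector `α` -/
  vec : V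

/-- The pointed chain `Δ_{u₁} ⋯ Δ_{u_j} (p; α)`. -/
def DifferenceElement.chain (D : DifferenceElement E V) : E →₀ V :=
  D.dirs.foldr (fun u A => difference u A) (Finsupp.single D.pt D.vec)

/-- `|Δ_U^j (p; α)|_j = ‖u₁‖ ⋯ ‖u_j‖ ‖α‖`. -/
def DifferenceElement.weight (D : DifferenceElement E V) : ℝ :=
  (D.dirs.map (fun u => ‖u‖)).prod * ‖D.vec‖

/-- The total weights of all the ways of writing `A` as a finite sum of difference chains
of order at most `r`. -/
def weights (r : ℕ) (A : E →₀ V) : Set ℝ :=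
  {c | ∃ L : List (DifferenceElement E V), (∀ D ∈ L, D.dirs.length ≤ r) ∧
    (L.map DifferenceElement.chain).sum = A ∧ (L.map DifferenceElement.weight).sum = c}

/-- The `r`-norm on pointed chains. -/
def rNorm (r : ℕ) (A : E →₀ V) : ℝ := sInf (weights r A)

theorem DifferenceElement.weight_nonneg (D : DifferenceElement E V) : 0 ≤ D.weight := by
  refine mul_nonneg (List.prod_nonneg ?_) (norm_nonneg _)
  intro x hx
  obtain ⟨u, -, rfl⟩ := List.mem_map.1 hx
  exact norm_nonneg u

theorem weights_nonneg {r : ℕ} {A : E →₀ V} {c : ℝ} (hc : c ∈ weights r A) : 0 ≤ c := by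
  obtain ⟨L, -, -, rfl⟩ := hc
  refine List.sum_nonneg ?_
  intro x hx
  obtain ⟨D, -, rfl⟩ := List.mem_map.1 hx
  exact D.weight_nonneg

theorem weights_bddBelow (r : ℕ) (A : E →₀ V) : BddBelow (weights r A) :=
  ⟨0, fun _ hc => weights_nonneg hc⟩

theorem rNorm_nonneg (r : ℕ) (A : E →₀ V) : 0 ≤ rNorm r A :=
  Real.sInf_nonneg fun _ hc => weights_nonneg hc

theorem rNorm_le {r : ℕ} {A : E →₀ V} {c : ℝ} (hc : c ∈ weights r A) : rNorm r A ≤ c :=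
  csInf_le (weights_bddBelow r A) hc

theorem weights_add {r : ℕ} {A B : E →₀ V} {a b : ℝ} (ha : a ∈ weights r A)
    (hb : b ∈ weights r B) : a + b ∈ weights r (A + B) := by
  obtain ⟨L, hL, rfl, rfl⟩ := ha
  obtain ⟨M, hM, rfl, rfl⟩ := hb
  refine ⟨L ++ M, ?_, by simp, by simp⟩
  intro D hD
  rcases List.mem_append.1 hD with h | h
  · exact hL D h
  · exact hM D h

theorem chain_mem_weights {r : ℕ} (D : DifferenceElement E V) (hD : D.dirs.length ≤ r) :
    D.weight ∈ weights r D.chain :=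
  ⟨[D], by simpa using hD, by simp, by simp⟩

theorem weights_nonempty (r : ℕ) (A : E →₀ V) : (weights r A).Nonempty := by
  induction A using Finsupp.induction_linear with
  | zero => exact ⟨0, [], by simp, by simp, by simp⟩
  | add A B hA hB =>
    obtain ⟨a, ha⟩ := hA
    obtain ⟨b, hb⟩ := hB
    exact ⟨a + b, weights_add ha hb⟩
  | single p α => exact ⟨_, chain_mem_weights ⟨[], p, α⟩ (by simp)⟩

/-- Linear maps that carry difference chains to difference chains, up to a factor `K` in weight,
are bounded. -/
theorem weights_map {W : Type*} [NormedAddCommGroup W] [NormedSpace ℝ W] {r s : ℕ}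
    (T : (E →₀ V) →ₗ[ℝ] (E →₀ W)) (K : ℝ)
    (h : ∀ D : DifferenceElement E V, D.dirs.length ≤ r →
      ∃ D' : DifferenceElement E W, D'.dirs.length ≤ s ∧ D'.chain = T D.chain ∧
        D'.weight ≤ K * D.weight) (hK : 0 ≤ K) (A : E →₀ V) :
    rNorm s (T A) ≤ K * rNorm r A := by
  have key : ∀ L : List (DifferenceElement E V), (∀ D ∈ L, D.dirs.length ≤ r) →
      rNorm s (T (L.map DifferenceElement.chain).sum) ≤
        K * (L.map DifferenceElement.weight).sum := by
    intro L hL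
    suffices ∃ c ∈ weights s (T (L.map DifferenceElement.chain).sum),
        c ≤ K * (L.map DifferenceElement.weight).sum by
      obtain ⟨c, hc, hc'⟩ := this
      exact (rNorm_le hc).trans hc'
    induction L with
    | nil => exact ⟨0, ⟨[], by simp, by simp, by simp⟩, by simp⟩
    | cons D L ih =>
      obtain ⟨c, hc, hc'⟩ := ih fun D hD => hL D (List.mem_cons_of_mem _ hD)
      obtain ⟨D', h1, h2, h3⟩ := h D (hL D List.mem_cons_self)
      refine ⟨D'.weight + c, ?_, ?_⟩
      · rw [List.map_cons, List.sum_cons, map_add, ← h2]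
        exact weights_add (chain_mem_weights D' h1) hc
      · rw [List.map_cons, List.sum_cons, mul_add]
        exact add_le_add h3 hc'
  rcases hK.eq_or_lt with rfl | hK
  · obtain ⟨c, L, hL, rfl, -⟩ := weights_nonempty r A
    simpa using key L hL
  · rw [← div_le_iff₀' hK]
    refine le_csInf (weights_nonempty r A) ?_
    rintro c ⟨L, hL, rfl, rfl⟩
    rw [div_le_iff₀' hK]
    exact key L hL

theorem rNorm_add (r : ℕ) (A B : E →₀ V) : rNorm r (A + B) ≤ rNorm r A + rNorm r B := by
  refine le_of_forall_pos_le_add fun ε hε => ?_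
  obtain ⟨a, ha, ha'⟩ := Real.lt_sInf_add_pos (weights_nonempty r A) (half_pos hε)
  obtain ⟨b, hb, hb'⟩ := Real.lt_sInf_add_pos (weights_nonempty r B) (half_pos hε)
  have := rNorm_le (weights_add ha hb)
  unfold rNorm at *
  linarith

theorem map_chain_aux {W : Type*} [NormedAddCommGroup W] [NormedSpace ℝ W]
    (T : (E →₀ V) →ₗ[ℝ] (E →₀ W)) (hT : ∀ (u : E) (A : E →₀ V),
      T (difference u A) = difference u (T A)) (U : List E) (A : E →₀ V) :
    T (U.foldr (fun u A => difference u A) A) = U.foldr (fun u A => difference u A) (T A) := by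
  induction U with
  | nil => rfl
  | cons u U ih => rw [List.foldr_cons, List.foldr_cons, hT, ih]

variable (E V) in
/-- The map induced on pointed chains by a linear map of the fibres. -/
def mapFibre {W : Type*} [NormedAddCommGroup W] [NormedSpace ℝ W] (ℓ : V →L[ℝ] W) :
    (E →₀ V) →ₗ[ℝ] (E →₀ W) :=
  Finsupp.mapRange.linearMap (ℓ : V →ₗ[ℝ] W)

theorem mapFibre_difference {W : Type*} [NormedAddCommGroup W] [NormedSpace ℝ W]
    (ℓ : V →L[ℝ] W) (u : E) (A : E →₀ V) :
    mapFibre E V ℓ (difference u A) = difference u (mapFibre E V ℓ A) := by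
  induction A using Finsupp.induction_linear with
  | zero => simp
  | add A B hA hB => simp only [map_add, hA, hB]
  | single p α =>
    simp only [difference, LinearMap.sub_apply, map_sub]
    simp [mapFibre, translate, Finsupp.mapDomain_single]

theorem rNorm_mapFibre {W : Type*} [NormedAddCommGroup W] [NormedSpace ℝ W]
    (r : ℕ) (ℓ : V →L[ℝ] W) (A : E →₀ V) :
    rNorm r (mapFibre E V ℓ A) ≤ ‖ℓ‖ * rNorm r A := by
  refine weights_map (mapFibre E V ℓ) ‖ℓ‖ ?_ (norm_nonneg _) A
  intro D hD
  refine ⟨⟨D.dirs, D.pt, ℓ D.vec⟩, hD, ?_, ?_⟩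
  · unfold DifferenceElement.chain
    rw [map_chain_aux _ (mapFibre_difference ℓ)]
    simp [mapFibre]
  · have h1 : 0 ≤ (D.dirs.map (fun u => ‖u‖)).prod := by
      refine List.prod_nonneg ?_
      intro x hx
      obtain ⟨u, -, rfl⟩ := List.mem_map.1 hx
      exact norm_nonneg u
    have h2 := mul_le_mul_of_nonneg_left (ℓ.le_opNorm D.vec) h1
    unfold DifferenceElement.weight
    calc _ ≤ _ := h2
      _ = _ := by ring

theorem rNorm_smul_le (r : ℕ) (c : ℝ) (A : E →₀ V) : rNorm r (c • A) ≤ |c| * rNorm r A := by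
  have h := rNorm_mapFibre r (c • ContinuousLinearMap.id ℝ V) A
  have h1 : mapFibre E V (c • ContinuousLinearMap.id ℝ V) A = c • A := by
    ext p
    simp [mapFibre]
  rw [h1] at h
  refine h.trans (mul_le_mul_of_nonneg_right ?_ (rNorm_nonneg r A))
  rw [norm_smul, Real.norm_eq_abs]
  exact mul_le_of_le_one_right (abs_nonneg c) ContinuousLinearMap.norm_id_le

theorem rNorm_smul (r : ℕ) (c : ℝ) (A : E →₀ V) : rNorm r (c • A) = |c| * rNorm r A := by
  refine le_antisymm (rNorm_smul_le r c A) ?_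
  rcases eq_or_ne c 0 with rfl | hc
  · simpa using rNorm_nonneg r (0 : E →₀ V)
  · have h := rNorm_smul_le r c⁻¹ (c • A)
    rw [inv_smul_smul₀ hc, abs_inv, ← div_eq_inv_mul, le_div_iff₀' (abs_pos.2 hc)] at h
    exact h

theorem rNorm_difference (r : ℕ) (u : E) (A : E →₀ V) :
    rNorm (r + 1) (difference u A) ≤ ‖u‖ * rNorm r A := by
  refine weights_map (difference u) ‖u‖ ?_ (norm_nonneg _) A
  intro D hD
  refine ⟨⟨u :: D.dirs, D.pt, D.vec⟩, by simpa using hD, rfl, ?_⟩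
  simp [DifferenceElement.weight, mul_assoc]

theorem rNorm_mono {r s : ℕ} (h : r ≤ s) (A : E →₀ V) : rNorm s A ≤ rNorm r A := by
  simpa using weights_map (LinearMap.id : (E →₀ V) →ₗ[ℝ] (E →₀ V)) 1
    (fun D hD => ⟨D, hD.trans h, rfl, by simp⟩) zero_le_one A

theorem rNorm_single (r : ℕ) (p : E) (α : V) : rNorm r (Finsupp.single p α) ≤ ‖α‖ := by
  simpa [DifferenceElement.weight, DifferenceElement.chain] using
    rNorm_le (chain_mem_weights (r := r) (⟨[], p, α⟩ : DifferenceElement E V) (by simp))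

end Chains

/-! ## The Banach spaces of differential chains -/

/-- The space of pointed chains on `E` with fibre `V`, carrying the `r`-norm. -/
@[nolint unusedArguments]
def PointedChain (E V : Type*) [NormedAddCommGroup E] [NormedSpace ℝ E]
    [NormedAddCommGroup V] [NormedSpace ℝ V] (_r : ℕ) : Type _ := E →₀ V

section Spaces

variable (E V : Type*) [NormedAddCommGroup E] [NormedSpace ℝ E]
  [NormedAddCommGroup V] [NormedSpace ℝ V] (r : ℕ)

instance : AddCommGroup (PointedChain E V r) := inferInstanceAs (AddCommGroup (E →₀ V))

instance : Module ℝ (PointedChain E V r) := inferInstanceAs (Module ℝ (E →₀ V))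

instance : Norm (PointedChain E V r) := ⟨fun A => rNorm (E := E) (V := V) r A⟩

theorem pointedChainCore : SeminormedSpace.Core ℝ (PointedChain E V r) where
  norm_nonneg A := rNorm_nonneg (E := E) (V := V) r A
  norm_smul c A := rNorm_smul (E := E) (V := V) r c A
  norm_triangle A B := rNorm_add (E := E) (V := V) r A B

instance : SeminormedAddCommGroup (PointedChain E V r) :=
  SeminormedAddCommGroup.ofCore (pointedChainCore E V r)

instance : NormedSpace ℝ (PointedChain E V r) where
  norm_smul_le c A := (rNorm_smul (E := E) (V := V) r c A).le

/-- A pointed chain, viewed in the space with the `r`-norm. -/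
def PointedChain.of : (E →₀ V) ≃ₗ[ℝ] PointedChain E V r := LinearEquiv.refl ℝ (E →₀ V)

theorem PointedChain.norm_of (A : E →₀ V) : ‖PointedChain.of E V r A‖ = rNorm r A := rfl

/-- The Banach space of differential chains of order `r`: the completion of the pointed chains
in the `r`-norm. `Chain E ℝ r` is the space of `0`-chains, `Chain E E r` that of `1`-chains. -/
abbrev Chain : Type _ := UniformSpace.Completion (PointedChain E V r)

variable {E V} in
/-- A pointed chain as a differential chain of order `r`. -/
def toChain : (E →₀ V) →ₗ[ℝ] Chain E V r :=
  (UniformSpace.Completion.toComplₗᵢ (𝕜 := ℝ) (E := PointedChain E V r)).toLinearMap ∘ₗ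
    (PointedChain.of E V r).toLinearMap

variable {E V} in
theorem norm_toChain (A : E →₀ V) : ‖toChain r A‖ = rNorm r A :=
  UniformSpace.Completion.norm_coe (PointedChain.of E V r A)

variable {E V r} in
/-- The continuous extension to differential chains of order `r` of a linear map on pointed chains
that is bounded in the `r`-norm. -/
def extend {F : Type*} [NormedAddCommGroup F] [NormedSpace ℝ F] [CompleteSpace F]
    (T : (E →₀ V) →ₗ[ℝ] F) (hT : ∃ C : ℝ, ∀ A, ‖T A‖ ≤ C * rNorm r A) : Chain E V r →L[ℝ] F :=
  ((T ∘ₗ (PointedChain.of E V r).symm.toLinearMap).mkContinuousOfExistsBound hT).extend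
    (UniformSpace.Completion.toComplL (𝕜 := ℝ) (E := PointedChain E V r))

variable {E V r} in
theorem extend_toChain {F : Type*} [NormedAddCommGroup F] [NormedSpace ℝ F] [CompleteSpace F]
    (T : (E →₀ V) →ₗ[ℝ] F) (hT : ∃ C : ℝ, ∀ A, ‖T A‖ ≤ C * rNorm r A) (A : E →₀ V) :
    extend T hT (toChain r A) = T A :=
  ContinuousLinearMap.extend_eq _ UniformSpace.Completion.denseRange_coe
    (UniformSpace.Completion.isUniformInducing_coe _) (PointedChain.of E V r A)

end Spaces

/-! ## Forms and the Harrison integral -/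

section Forms

variable {E V F : Type*} [NormedAddCommGroup E] [NormedSpace ℝ E]
  [NormedAddCommGroup V] [NormedSpace ℝ V] [NormedAddCommGroup F] [NormedSpace ℝ F]

/-- Evaluation of an `F`-valued form on pointed chains, `ω(∑ (pᵢ; αᵢ)) = ∑ ω_{pᵢ}(αᵢ)`. -/
def evalForm (ω : E → V →L[ℝ] F) : (E →₀ V) →ₗ[ℝ] F :=
  Finsupp.lsum ℝ fun p => (ω p : V →ₗ[ℝ] F)

/-- `ω` belongs to the space `ℬ^r`: for some `C`, `|ω(Δ_U^j (p; α))| ≤ C |Δ_U^j (p; α)|_j` for all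
`0 ≤ j ≤ r`. (For `j = 0` this says that `ω` is bounded.) -/
def IsBForm (r : ℕ) (ω : E → V →L[ℝ] F) : Prop :=
  ∃ C : ℝ, ∀ D : DifferenceElement E V, D.dirs.length ≤ r →
    ‖evalForm ω D.chain‖ ≤ C * D.weight

theorem IsBForm.bound {r : ℕ} {ω : E → V →L[ℝ] F} (hω : IsBForm r ω) :
    ∃ C : ℝ, ∀ A, ‖evalForm ω A‖ ≤ C * rNorm r A := by
  obtain ⟨C, hC⟩ := hω
  have hC' : ∀ D : DifferenceElement E V, D.dirs.length ≤ r →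
      ‖evalForm ω D.chain‖ ≤ (|C| + 1) * D.weight := fun D hD =>
    (hC D hD).trans (mul_le_mul_of_nonneg_right (by linarith [le_abs_self C]) D.weight_nonneg)
  have hpos : 0 < |C| + 1 := by positivity
  refine ⟨|C| + 1, fun A => ?_⟩
  rw [← div_le_iff₀' hpos]
  refine le_csInf (weights_nonempty r A) ?_
  rintro c ⟨L, hL, rfl, rfl⟩
  rw [div_le_iff₀' hpos]
  induction L with
  | nil => simp
  | cons D L ih =>
    rw [List.map_cons, List.sum_cons, map_add, List.map_cons, List.sum_cons, mul_add]
    exact (norm_add_le _ _).trans (add_le_add (hC' D (hL D List.mem_cons_self))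
      (ih fun D hD => hL D (List.mem_cons_of_mem _ hD)))

/-- The Harrison integral over differential chains of order `r` of a global form in `ℬ^r`. -/
def integral [CompleteSpace F] {r : ℕ} (ω : E → V →L[ℝ] F) (hω : IsBForm r ω) :
    Chain E V r →L[ℝ] F :=
  extend (evalForm ω) hω.bound

end Forms

/-! ## Support -/

section Support

variable {E V : Type*} [NormedAddCommGroup E] [NormedSpace ℝ E]
  [NormedAddCommGroup V] [NormedSpace ℝ V] {r : ℕ}

/-- The closed set `X` supports `J`: for every non-empty open `W ⊇ X`, the chain `J` is a limit of
pointed chains supported in `W`. -/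
def Supports (X : Set E) (J : Chain E V r) : Prop :=
  IsClosed X ∧ ∀ W : Set E, W.Nonempty → IsOpen W → X ⊆ W →
    ∃ A : ℕ → E →₀ V, (∀ i, ((A i).support : Set E) ⊆ W) ∧
      Tendsto (fun i => toChain r (A i)) atTop (𝓝 J)

/-- The support of a differential chain: the intersection of all closed sets that support it. -/
def supp (J : Chain E V r) : Set E := ⋂₀ {X | Supports X J}

variable {F : Type*} [NormedAddCommGroup F] [NormedSpace ℝ F] [CompleteSpace F]

/-- `c` is the Harrison integral over `J` of a form `ω` given near `supp J`, computed with a global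
form `η` of class `ℬ^r` that agrees with `ω` on a neighbourhood of `supp J`. -/
def IsLocalIntegral (J : Chain E V r) (ω : E → V →L[ℝ] F) (c : F) : Prop :=
  ∃ (U : Set E) (η : E → V →L[ℝ] F) (hη : IsBForm r η),
    IsOpen U ∧ supp J ⊆ U ∧ Set.EqOn η ω U ∧ integral η hη J = c

/-- The Harrison integral over `J` of the form `ω` is well defined. -/
def LocallyIntegrable (J : Chain E V r) (ω : E → V →L[ℝ] F) : Prop :=
  ∃! c : F, IsLocalIntegral J ω c

open Classical in
/-- The Harrison integral over `J` of a form `ω` given near `supp J` (`0` if it is not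
well defined). -/
def localIntegral (J : Chain E V r) (ω : E → V →L[ℝ] F) : F :=
  if h : LocallyIntegrable J ω then h.choose else 0

end Support

/-! ## Prederivative and boundary -/

/-- A Lipschitz curve with bilinearly bounded second differences has convergent difference
quotients at `0`. -/
theorem exists_tendsto_quotient {X : Type*} [NormedAddCommGroup X] [NormedSpace ℝ X]
    [CompleteSpace X] (f : ℝ → X) (K : ℝ) (hf : Continuous f)
    (h2 : ∀ a b h : ℝ, ‖(f (a + h) - f a) - (f (b + h) - f b)‖ ≤ K * (|a - b| * |h|)) :
    ∃ y, Tendsto (fun t : ℝ => t⁻¹ • (f t - f 0)) (𝓝[≠] 0) (𝓝 y) := by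
  have hK : 0 ≤ K := by simpa using (norm_nonneg _).trans (h2 1 0 1)
  -- integer multiples
  have hmul : ∀ (m : ℕ) (h : ℝ),
      ‖(f (m * h) - f 0) - (m : ℝ) • (f h - f 0)‖ ≤ K * ((m : ℝ) * |h|) ^ 2 := by
    intro m h
    induction m with
    | zero => simp
    | succ m ih =>
      have e := h2 (m * h) 0 h
      rw [zero_add, sub_zero, abs_mul, Nat.abs_cast] at e
      have : (f (((m + 1 : ℕ) : ℝ) * h) - f 0) - ((m + 1 : ℕ) : ℝ) • (f h - f 0) =
          ((f (m * h) - f 0) - (m : ℝ) • (f h - f 0)) +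
            ((f (m * h + h) - f (m * h)) - (f h - f 0)) := by
        rw [show ((m + 1 : ℕ) : ℝ) * h = m * h + h by push_cast; ring]
        push_cast
        module
      rw [this]
      refine (norm_add_le _ _).trans ((add_le_add ih e).trans ?_)
      have hm : (0 : ℝ) ≤ m := m.cast_nonneg
      have hh := abs_nonneg h
      push_cast
      have : 0 ≤ K * (|h| ^ 2 * (m + 1)) := by positivity
      nlinarith
  -- non-negative real multiples
  have hpos : ∀ x : ℝ, 0 ≤ x → ∀ t : ℝ,
      ‖(f (x * t) - f 0) - x • (f t - f 0)‖ ≤ K * t ^ 2 * (x ^ 2 + x) := by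
    intro x hx t
    have hlim : Tendsto (fun n : ℕ => (⌊x * n⌋₊ : ℝ) / n) atTop (𝓝 x) :=
      (tendsto_nat_floor_mul_div_atTop hx).comp tendsto_natCast_atTop_atTop
    have hL : Tendsto (fun n : ℕ => ‖(f ((⌊x * n⌋₊ : ℝ) / n * t) - f 0) -
        ((⌊x * n⌋₊ : ℝ) / n) • (f t - f 0)‖) atTop (𝓝 ‖(f (x * t) - f 0) - x • (f t - f 0)‖) := by
      have h1 := (hf.tendsto (x * t)).comp (hlim.mul_const t)
      exact ((h1.sub_const (f 0)).sub (hlim.smul_const (f t - f 0))).norm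
    have hR : Tendsto (fun n : ℕ => K * t ^ 2 *
        (((⌊x * n⌋₊ : ℝ) / n) ^ 2 + (⌊x * n⌋₊ : ℝ) / n)) atTop
        (𝓝 (K * t ^ 2 * (x ^ 2 + x))) :=
      ((hlim.pow 2).add hlim).const_mul _
    refine le_of_tendsto_of_tendsto hL hR ?_
    filter_upwards [eventually_gt_atTop 0] with n hn
    set m : ℕ := ⌊x * n⌋₊ with hm
    have hn' : (0 : ℝ) < n := Nat.cast_pos.2 hn
    have e1 := hmul m (t / n)
    have e2 := hmul n (t / n)
    rw [mul_div_cancel₀ t hn'.ne'] at e2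
    have hq : (0 : ℝ) ≤ (m : ℝ) / n := by positivity
    have e3 : (f ((m : ℝ) / n * t) - f 0) - ((m : ℝ) / n) • (f t - f 0) =
        ((f (m * (t / n)) - f 0) - (m : ℝ) • (f (t / n) - f 0)) -
          ((m : ℝ) / n) • ((f t - f 0) - (n : ℝ) • (f (t / n) - f 0)) := by
      rw [show (m : ℝ) / n * t = m * (t / n) by ring, smul_sub ((m : ℝ) / n) (f t - f 0),
        smul_smul, div_mul_cancel₀ _ hn'.ne']
      abel
    rw [e3]
    refine (norm_sub_le _ _).trans ?_
    rw [norm_smul, Real.norm_of_nonneg hq]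
    refine (add_le_add e1 (mul_le_mul_of_nonneg_left e2 hq)).trans (le_of_eq ?_)
    rw [mul_pow, mul_pow, sq_abs]
    field_simp
  -- all real multiples
  have hall : ∀ x t : ℝ,
      ‖(f (x * t) - f 0) - x • (f t - f 0)‖ ≤ 2 * K * t ^ 2 * (x ^ 2 + |x|) := by
    intro x t
    have hKt : 0 ≤ K * t ^ 2 := by positivity
    rcases le_total 0 x with hx | hx
    · refine (hpos x hx t).trans ?_
      rw [abs_of_nonneg hx]
      have : 0 ≤ K * t ^ 2 * (x ^ 2 + x) := by positivity
      linarith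
    · have e1 := hpos (-x) (by linarith) t
      have e2 := h2 (x * t) 0 (-x * t)
      rw [show x * t + -x * t = 0 by ring, zero_add, sub_zero, abs_mul, abs_mul, abs_neg] at e2
      have e3 : (f (x * t) - f 0) - x • (f t - f 0) =
          -(((f 0 - f (x * t)) - (f (-x * t) - f 0)) +
            ((f (-x * t) - f 0) - (-x) • (f t - f 0))) := by
        module
      rw [e3, norm_neg]
      refine (norm_add_le _ _).trans ((add_le_add e2 e1).trans ?_)
      have e4 : |x| * |t| * (|x| * |t|) = t ^ 2 * x ^ 2 := by
        rw [← sq_abs t, ← sq_abs x]; ring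
      rw [e4, abs_of_nonpos hx]
      have : 0 ≤ K * t ^ 2 * (-x) := mul_nonneg hKt (by linarith)
      nlinarith
  have hquot : ∀ s t : ℝ, s ≠ 0 → t ≠ 0 →
      ‖s⁻¹ • (f s - f 0) - t⁻¹ • (f t - f 0)‖ ≤ 2 * K * (|s| + |t|) := by
    intro s t hs ht
    have e := hall (s / t) t
    rw [div_mul_cancel₀ s ht] at e
    have e1 : s⁻¹ • (f s - f 0) - t⁻¹ • (f t - f 0) =
        s⁻¹ • ((f s - f 0) - (s / t) • (f t - f 0)) := by
      rw [smul_sub s⁻¹ (f s - f 0), smul_smul, show s⁻¹ * (s / t) = t⁻¹ by field_simp]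
    have hs' : 0 < |s| := abs_pos.2 hs
    have ht' : 0 < |t| := abs_pos.2 ht
    rw [e1, norm_smul, norm_inv, Real.norm_eq_abs, ← div_eq_inv_mul, div_le_iff₀ hs']
    refine e.trans (le_of_eq ?_)
    rw [← sq_abs t, ← sq_abs (s / t), abs_div]
    field_simp
  refine cauchy_map_iff_exists_tendsto.1 ?_
  rw [Metric.cauchy_iff]
  refine ⟨inferInstance, fun ε hε => ?_⟩
  have hδ : 0 < ε / (4 * K + 1) := by positivity
  refine ⟨(fun t : ℝ => t⁻¹ • (f t - f 0)) '' (Metric.ball 0 (ε / (4 * K + 1)) ∩ {0}ᶜ),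
    image_mem_map (inter_mem (mem_nhdsWithin_of_mem_nhds (Metric.ball_mem_nhds 0 hδ))
      self_mem_nhdsWithin), ?_⟩
  rintro _ ⟨s, ⟨hs, hs0⟩, rfl⟩ _ ⟨t, ⟨ht, ht0⟩, rfl⟩
  rw [dist_eq_norm]
  refine (hquot s t hs0 ht0).trans_lt ?_
  rw [mem_ball_zero_iff, Real.norm_eq_abs] at hs ht
  have h4 : (4 * K + 1) * (ε / (4 * K + 1)) = ε := by field_simp
  nlinarith

section Boundary

variable {E V : Type*} [NormedAddCommGroup E] [NormedSpace ℝ E]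
  [NormedAddCommGroup V] [NormedSpace ℝ V]

/-- The difference quotient `Δ_{tv}(A / t)`, as a chain of order `r + 1`. -/
def quotient (r : ℕ) (v : E) (A : E →₀ V) (t : ℝ) : Chain E V (r + 1) :=
  toChain (r + 1) (difference (t • v) (t⁻¹ • A))

theorem exists_tendsto_difference {r : ℕ} (hr : 1 ≤ r) (v : E) (A : E →₀ V) :
    ∃ J, Tendsto (quotient r v A) (𝓝[≠] 0) (𝓝 J) := by
  induction A using Finsupp.induction_linear with
  | zero => exact ⟨0, tendsto_const_nhds.congr fun t => by simp [quotient]⟩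
  | add A B hA hB =>
    obtain ⟨J, hJ⟩ := hA
    obtain ⟨K, hK⟩ := hB
    refine ⟨J + K, (hJ.add hK).congr fun t => ?_⟩
    simp [quotient, smul_add]
  | single p α =>
    set f : ℝ → Chain E V (r + 1) := fun t => toChain (r + 1) (Finsupp.single (p + t • v) α)
      with hf
    have hdiff : ∀ (q u : E), (Finsupp.single (q + u) α - Finsupp.single q α : E →₀ V) =
        difference u (Finsupp.single q α) := fun q u => by
      simp [difference, translate, Finsupp.mapDomain_single]
    have h1 : ∀ a h : ℝ, ‖f (a + h) - f a‖ ≤ ‖v‖ * ‖α‖ * |h| := by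
      intro a h
      rw [hf, ← map_sub, norm_toChain, add_smul, ← add_assoc, hdiff]
      refine (rNorm_difference r _ _).trans ?_
      rw [norm_smul, Real.norm_eq_abs]
      have := mul_le_mul_of_nonneg_left (rNorm_single r (p + a • v) α)
        (mul_nonneg (abs_nonneg h) (norm_nonneg v))
      linarith
    have h2 : ∀ a b h : ℝ, ‖(f (a + h) - f a) - (f (b + h) - f b)‖ ≤
        ‖v‖ * ‖v‖ * ‖α‖ * (|a - b| * |h|) := by
      intro a b h
      have e : (f (a + h) - f a) - (f (b + h) - f b) = toChain (r + 1)
          (difference (h • v) (difference ((a - b) • v) (Finsupp.single (p + b • v) α))) := by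
        rw [← hdiff, map_sub (difference (h • v)), ← hdiff, ← hdiff]
        simp only [hf, map_sub]
        rw [show p + b • v + (a - b) • v = p + a • v by module, add_smul, add_smul,
          ← add_assoc, ← add_assoc]
      rw [e, norm_toChain]
      refine (rNorm_mono (Nat.succ_le_succ hr) _).trans ((rNorm_difference 1 _ _).trans ?_)
      refine (mul_le_mul_of_nonneg_left ((rNorm_difference 0 _ _).trans
        (mul_le_mul_of_nonneg_left (rNorm_single 0 _ α) (norm_nonneg _))) (norm_nonneg _)).trans ?_
      rw [norm_smul, norm_smul, Real.norm_eq_abs, Real.norm_eq_abs]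
      exact le_of_eq (by ring)
    have hcont : Continuous f := by
      refine (LipschitzWith.of_dist_le_mul (K := ⟨‖v‖ * ‖α‖, by positivity⟩) ?_).continuous
      intro a b
      have := h1 b (a - b)
      rw [add_sub_cancel] at this
      rw [dist_eq_norm, Real.dist_eq]
      exact this
    obtain ⟨y, hy⟩ := exists_tendsto_quotient f _ hcont h2
    refine ⟨y, hy.congr fun t => ?_⟩
    rw [quotient, map_smul, map_smul, ← hdiff, hf]
    simp

/-- The prederivative `P_v A = lim_{t → 0} Δ_{tv}(A / t)` of a pointed chain, a differential chain
of order `r + 1` for every `r ≥ 1`. -/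
def prederivPointed (r : ℕ) (v : E) (A : E →₀ V) : Chain E V (r + 1) :=
  limUnder (𝓝[≠] 0) (quotient r v A)

theorem tendsto_prederivPointed {r : ℕ} (hr : 1 ≤ r) (v : E) (A : E →₀ V) :
    Tendsto (quotient r v A) (𝓝[≠] 0) (𝓝 (prederivPointed r v A)) :=
  tendsto_nhds_limUnder (exists_tendsto_difference hr v A)

/-- The prederivative on pointed chains, as a linear map. -/
def prederivLinear (r : ℕ) (hr : 1 ≤ r) (v : E) : (E →₀ V) →ₗ[ℝ] Chain E V (r + 1) where
  toFun := prederivPointed r v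
  map_add' A B := by
    refine tendsto_nhds_unique (tendsto_prederivPointed hr v (A + B)) ?_
    refine ((tendsto_prederivPointed hr v A).add (tendsto_prederivPointed hr v B)).congr fun t => ?_
    simp [quotient, smul_add]
  map_smul' c A := by
    refine tendsto_nhds_unique (tendsto_prederivPointed hr v (c • A)) ?_
    refine ((tendsto_prederivPointed hr v A).const_smul c).congr fun t => ?_
    simp only [quotient, map_smul]
    exact smul_comm _ _ _

theorem norm_prederivLinear_le (r : ℕ) (hr : 1 ≤ r) (v : E) (A : E →₀ V) :
    ‖prederivLinear r hr v A‖ ≤ ‖v‖ * rNorm r A := by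
  refine le_of_tendsto (tendsto_prederivPointed hr v A).norm ?_
  filter_upwards [self_mem_nhdsWithin] with t ht
  have ht' : 0 < |t| := abs_pos.2 ht
  rw [quotient, norm_toChain]
  refine (rNorm_difference r _ _).trans (le_of_eq ?_)
  rw [norm_smul, rNorm_smul, Real.norm_eq_abs, abs_inv]
  field_simp

/-- The prederivative `P_v`, extended continuously from pointed chains to differential chains of
order `r ≥ 1`. -/
def prederiv (r : ℕ) (hr : 1 ≤ r) (v : E) : Chain E V r →L[ℝ] Chain E V (r + 1) :=
  extend (prederivLinear r hr v) ⟨‖v‖, norm_prederivLinear_le r hr v⟩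

end Boundary

section Closed

variable {E : Type*} [NormedAddCommGroup E] [InnerProductSpace ℝ E]

/-- Retraction `E_v^†` from `1`-chains to `0`-chains, the continuous extension of
`(p; w) ↦ (p; ⟨v, w⟩)`. -/
def retraction (r : ℕ) (v : E) : Chain E E r →L[ℝ] Chain E ℝ r :=
  extend (toChain r ∘ₗ mapFibre E E (innerSL ℝ v))
    ⟨‖innerSL ℝ v‖, fun A => (norm_toChain r _).trans_le (rNorm_mapFibre r (innerSL ℝ v) A)⟩

/-- The boundary `∂ = ∑ᵢ P_{vᵢ} ∘ E_{vᵢ}^†` of `1`-chains of order `r ≥ 1` in the plane, where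
`v₁ = 1`, `v₂ = i` is the standard orthonormal basis of `ℂ = ℝ²`. -/
def boundary (r : ℕ) (hr : 1 ≤ r) : Chain ℂ ℂ r →L[ℝ] Chain ℂ ℝ (r + 1) :=
  ∑ i : Fin 2, prederiv r hr (Complex.orthonormalBasisOneI i) ∘L
    retraction r (Complex.orthonormalBasisOneI i)

/-- The differential `1`-chain `J` is closed: `∂J = 0`. -/
def IsClosedChain {r : ℕ} (hr : 1 ≤ r) (J : Chain ℂ ℂ r) : Prop := boundary r hr J = 0

end Closed

/-! ## Winding number -/

/-- The complex `1`-form `dw / (w - z)`. -/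
def cauchyForm (z : ℂ) (w : ℂ) : ℂ →L[ℝ] ℂ := (w - z)⁻¹ • ContinuousLinearMap.id ℝ ℂ

/-- The winding number `Ind_J(z) = (1 / 2πi) ∫_J dw / (w - z)`. -/
def windingNumber {r : ℕ} (J : Chain ℂ ℂ r) (z : ℂ) : ℂ :=
  (2 * Real.pi * Complex.I)⁻¹ * localIntegral J (cauchyForm z)

end DiffChain

end

/-! If `|a - b| < |w - b|` for every `w` in `supp J`, then `(w - a)/(w - b)` stays in the disc of
radius `1` about `1`, so its principal logarithm is a smooth primitive of `dw/(w - a) - dw/(w - b)`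
near `supp J`. A closed chain integrates exact forms to `0` by Stokes' theorem (`integral_boundary`,
`isLocalIntegral_zero_of_hasFDerivAt`). Hence the winding number is locally constant off `supp J`,
and so constant on components. When `|z|` exceeds every `|w|` with `w` in `supp J`, the form `dw/(w
- z)` itself has the primitive `log (1 - w/z)`, so the winding number is `0` there; an unbounded
component contains such a `z`.

The longer half of the work is well-definedness: a form of class `ℬ^r` vanishing near `supp J` must
have integral `0` (`integral_eq_zero_of_eqOn_supp`). The set `supp J` is an intersection of
supporting sets and is not assumed to support `J`, so forms are first cut off near single points
outside it, then on compact sets (`exists_cutout`), and finally everywhere by an exhaustion of the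
space with uniformly bounded cutoffs. These cutoffs need the class `ℬ^r` to be stable under
products, which is a Leibniz rule for iterated differences (`DiffBound.smul`). -/

namespace DiffChain

open Set

/-! ## Iterated finite differences of functions -/

section IteratedDiff

open scoped ContDiff

variable {E G : Type*} [NormedAddCommGroup E] [NormedSpace ℝ E]
  [NormedAddCommGroup G] [NormedSpace ℝ G]

/-- The iterated finite difference `p ↦ (δ_{u₁} ⋯ δ_{u_j} f)(p)`, where
`(δ_u f)(p) = f (p + u) - f p`. -/
def iteratedDiff : List E → (E → G) → E → G
  | [], f => f
  | u :: U, f => iteratedDiff U fun p => f (p + u) - f p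

/-- All iterated differences of `f` of order at most `r` satisfy
`‖δ_U f‖ ≤ C ‖u₁‖ ⋯ ‖u_j‖`. -/
def DiffBound (r : ℕ) (f : E → G) (C : ℝ) : Prop :=
  ∀ U : List E, U.length ≤ r → ∀ p, ‖iteratedDiff U f p‖ ≤ C * (U.map fun u => ‖u‖).prod

theorem prod_norm_nonneg (U : List E) : 0 ≤ (U.map fun u => ‖u‖).prod := by
  refine List.prod_nonneg fun x hx => ?_
  obtain ⟨u, -, rfl⟩ := List.mem_map.1 hx
  exact norm_nonneg u

theorem iteratedDiff_add (U : List E) (f g : E → G) :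
    iteratedDiff U (fun p => f p + g p) = fun p => iteratedDiff U f p + iteratedDiff U g p := by
  induction U generalizing f g with
  | nil => rfl
  | cons u U ih =>
    simp only [iteratedDiff]
    rw [← ih]
    congr 1
    funext p
    abel

theorem iteratedDiff_sub (U : List E) (f g : E → G) :
    iteratedDiff U (fun p => f p - g p) = fun p => iteratedDiff U f p - iteratedDiff U g p := by
  induction U generalizing f g with
  | nil => rfl
  | cons u U ih =>
    simp only [iteratedDiff]
    rw [← ih]
    congr 1
    funext p
    abel

theorem iteratedDiff_comp_add (U : List E) (f : E → G) (v : E) :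
    iteratedDiff U (fun p => f (p + v)) = fun p => iteratedDiff U f (p + v) := by
  induction U generalizing f with
  | nil => rfl
  | cons u U ih =>
    simp only [iteratedDiff]
    rw [← ih]
    congr 1
    funext p
    rw [add_right_comm]

/-- Differences commute with sums and translations, so the first direction, taken innermost in the
definition, may also be taken outermost. -/
theorem iteratedDiff_cons (u : E) (U : List E) (f : E → G) (p : E) :
    iteratedDiff (u :: U) f p = iteratedDiff U f (p + u) - iteratedDiff U f p := by
  simp only [iteratedDiff]
  rw [iteratedDiff_sub, iteratedDiff_comp_add]

theorem iteratedDiff_comp_smul (U : List E) (f : E → G) (c : ℝ) :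
    iteratedDiff U (fun p => f (c • p)) = fun p => iteratedDiff (U.map (c • ·)) f (c • p) := by
  induction U generalizing f with
  | nil => rfl
  | cons u U ih =>
    simp only [iteratedDiff, List.map_cons]
    rw [← ih]
    congr 1
    funext p
    rw [smul_add]

theorem iteratedDiff_const (u : E) (U : List E) (c : G) :
    iteratedDiff (u :: U) (fun _ => c) = fun _ => 0 := by
  induction U generalizing u c with
  | nil => simp [iteratedDiff]
  | cons v U ih =>
    have h := ih u 0
    simp only [iteratedDiff, sub_self] at h ⊢
    exact h

theorem DiffBound.const (r : ℕ) (c : G) : DiffBound (E := E) r (fun _ => c) ‖c‖ := by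
  rintro (_ | ⟨u, U⟩) - p
  · simp [iteratedDiff]
  · rw [iteratedDiff_const, norm_zero]
    exact mul_nonneg (norm_nonneg _) (prod_norm_nonneg _)

theorem DiffBound.nonneg {r : ℕ} {f : E → G} {C : ℝ} (h : DiffBound r f C) : 0 ≤ C := by
  simpa using (norm_nonneg _).trans (h [] (by simp) 0)

theorem DiffBound.sub {r : ℕ} {f g : E → G} {C D : ℝ} (hf : DiffBound r f C)
    (hg : DiffBound r g D) : DiffBound r (fun p => f p - g p) (C + D) := by
  intro U hU p
  rw [iteratedDiff_sub, add_mul]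
  exact (norm_sub_le _ _).trans (add_le_add (hf U hU p) (hg U hU p))

theorem DiffBound.comp_add {r : ℕ} {f : E → G} {C : ℝ} (hf : DiffBound r f C) (v : E) :
    DiffBound r (fun p => f (p + v)) C := by
  intro U hU p
  rw [iteratedDiff_comp_add]
  exact hf U hU _

theorem DiffBound.pred {r : ℕ} {f : E → G} {C : ℝ} (hf : DiffBound (r + 1) f C) :
    DiffBound r f C := fun U hU p => hf U (hU.trans r.le_succ) p

theorem DiffBound.diff {r : ℕ} {f : E → G} {C : ℝ} (hf : DiffBound (r + 1) f C) (v : E) :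
    DiffBound r (fun p => f (p + v) - f p) (C * ‖v‖) := by
  intro U hU p
  have := hf (v :: U) (by simpa using hU) p
  rwa [List.map_cons, List.prod_cons, ← mul_assoc] at this

/-- Rescaling by `c` shortens every direction, so the constant does not grow. This makes the cutoffs
`χ (p / (n + 1))` uniformly bounded in `n`. -/
theorem DiffBound.comp_smul {r : ℕ} {f : E → G} {C : ℝ} (hf : DiffBound r f C) {c : ℝ}
    (hc : |c| ≤ 1) : DiffBound r (fun p => f (c • p)) C := by
  intro U hU p
  rw [iteratedDiff_comp_smul]
  refine (hf (U.map (c • ·)) (by simpa using hU) _).trans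
    (mul_le_mul_of_nonneg_left ?_ hf.nonneg)
  clear hU
  induction U with
  | nil => simp
  | cons u U ih =>
    simp only [List.map_cons, List.prod_cons]
    refine mul_le_mul ?_ ih (prod_norm_nonneg _) (norm_nonneg _)
    rw [norm_smul, Real.norm_eq_abs]
    exact mul_le_of_le_one_left (norm_nonneg _) hc

/-- The Leibniz rule for finite differences, in the form of a bound. -/
theorem DiffBound.smul {r : ℕ} {χ : E → ℝ} {f : E → G} {a b : ℝ} (hχ : DiffBound r χ a)
    (hf : DiffBound r f b) : DiffBound r (fun p => χ p • f p) (2 ^ r * (a * b)) := by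
  induction r generalizing χ f a b with
  | zero =>
    intro U hU p
    obtain rfl := List.length_eq_zero_iff.1 (Nat.le_zero.1 hU)
    have h1 := hχ [] le_rfl p
    have h2 := hf [] le_rfl p
    simp only [iteratedDiff, List.map_nil, List.prod_nil, mul_one, pow_zero, one_mul] at h1 h2 ⊢
    rw [norm_smul]
    exact mul_le_mul h1 h2 (norm_nonneg _) hχ.nonneg
  | succ r ih =>
    have hab : 0 ≤ a * b := mul_nonneg hχ.nonneg hf.nonneg
    rintro (_ | ⟨u, U⟩) hU p
    · have h := ih hχ.pred hf.pred [] (by simp) p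
      refine h.trans (mul_le_mul_of_nonneg_right ?_ (prod_norm_nonneg _))
      rw [pow_succ]
      have : 0 ≤ 2 ^ r * (a * b) := by positivity
      linarith
    · have hU' : U.length ≤ r := by simpa using hU
      have h1 := ih (hχ.pred.comp_add u) (hf.diff u) U hU' p
      have h2 := ih (hχ.diff u) hf.pred U hU' p
      -- The product rule for one difference. Each of the two terms has one difference already spent
      -- and obeys the bound of order `r`, so passing to order `r + 1` doubles the constant.
      have e : iteratedDiff (u :: U) (fun p => χ p • f p) p =
          iteratedDiff U (fun p => χ (p + u) • (f (p + u) - f p)) p +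
            iteratedDiff U (fun p => (χ (p + u) - χ p) • f p) p := by
        rw [← congrFun (iteratedDiff_add U _ _) p]
        simp only [iteratedDiff]
        congr 1
        funext q
        module
      rw [e, List.map_cons, List.prod_cons]
      refine (norm_add_le _ _).trans ((add_le_add h1 h2).trans (le_of_eq ?_))
      ring

theorem contDiff_iteratedDiff (U : List E) {f : E → G} (hf : ContDiff ℝ ∞ f) :
    ContDiff ℝ ∞ (iteratedDiff U f) := by
  induction U generalizing f with
  | nil => exact hf
  | cons u U ih => exact ih ((hf.comp (contDiff_id.add contDiff_const)).sub hf)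

theorem fderiv_iteratedDiff (U : List E) {f : E → G} (hf : ContDiff ℝ ∞ f) :
    fderiv ℝ (iteratedDiff U f) = iteratedDiff U (fderiv ℝ f) := by
  induction U generalizing f with
  | nil => rfl
  | cons u U ih =>
    have hd : Differentiable ℝ f := hf.differentiable (by simp)
    simp only [iteratedDiff]
    rw [ih (f := fun p => f (p + u) - f p)
      ((hf.comp (contDiff_id.add contDiff_const)).sub hf)]
    congr 1
    funext p
    rw [fderiv_fun_sub (f := fun p => f (p + u))
      ((hd _).comp p ((differentiableAt_id).add_const u)) (hd p), fderiv_comp_add_right]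

end IteratedDiff

/-! ### Difference bounds for smooth compactly supported functions -/

section Smooth

open scoped ContDiff

variable {E : Type} [NormedAddCommGroup E] [NormedSpace ℝ E]

/-- The mean value inequality trades one difference for one derivative, and derivatives commute with
differences. The induction therefore passes from `f` to `fderiv ℝ f`, whose values lie in another
space; this is why `G` varies and shares its universe with `E`. -/
theorem exists_iteratedDiff_bound (j : ℕ) {G : Type} [NormedAddCommGroup G] [NormedSpace ℝ G]
    {f : E → G} (hf : ContDiff ℝ ∞ f) (hs : HasCompactSupport f) :
    ∃ C, 0 ≤ C ∧ ∀ U : List E, U.length = j → ∀ p,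
      ‖iteratedDiff U f p‖ ≤ C * (U.map fun u => ‖u‖).prod := by
  induction j generalizing G with
  | zero =>
    obtain ⟨C, hC⟩ := hs.exists_bound_of_continuous hf.continuous
    refine ⟨C, (norm_nonneg _).trans (hC 0), fun U hU p => ?_⟩
    obtain rfl := List.length_eq_zero_iff.1 hU
    simpa [iteratedDiff] using hC p
  | succ j ih =>
    obtain ⟨C, hC0, hC⟩ := ih (hf.fderiv_right (m := ∞) (by simp)) (hs.fderiv (𝕜 := ℝ))
    refine ⟨C, hC0, ?_⟩
    rintro (_ | ⟨u, U⟩) hU p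
    · simp at hU
    · rw [iteratedDiff_cons, List.map_cons, List.prod_cons]
      have hd := (contDiff_iteratedDiff U hf).differentiable (by simp)
      have := convex_univ.norm_image_sub_le_of_norm_fderiv_le (𝕜 := ℝ)
        (f := iteratedDiff U f) (C := C * (U.map fun u => ‖u‖).prod)
        (fun x _ => hd x) (fun x _ => by
          rw [fderiv_iteratedDiff U hf]
          exact hC U (by simpa using hU) x) (mem_univ p) (mem_univ (p + u))
      rw [add_sub_cancel_left] at this
      exact this.trans (le_of_eq (by ring))

theorem exists_diffBound (r : ℕ) {G : Type} [NormedAddCommGroup G] [NormedSpace ℝ G]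
    {f : E → G} (hf : ContDiff ℝ ∞ f) (hs : HasCompactSupport f) : ∃ C, DiffBound r f C := by
  choose C hC0 hC using fun j => exists_iteratedDiff_bound j hf hs
  refine ⟨∑ j ∈ Finset.range (r + 1), C j, fun U hU p => (hC U.length U rfl p).trans
    (mul_le_mul_of_nonneg_right ?_ (prod_norm_nonneg U))⟩
  exact Finset.single_le_sum (fun j _ => hC0 j) (Finset.mem_range.2 (by omega))

end Smooth

/-! ## Forms of class `ℬ^r` and finite differences -/

section Forms

variable {E V F : Type*} [NormedAddCommGroup E] [NormedSpace ℝ E]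
  [NormedAddCommGroup V] [NormedSpace ℝ V] [NormedAddCommGroup F] [NormedSpace ℝ F]

theorem evalForm_single (θ : E → V →L[ℝ] F) (p : E) (α : V) :
    evalForm θ (Finsupp.single p α) = θ p α := by
  simp [evalForm]

theorem evalForm_sub (θ η : E → V →L[ℝ] F) (A : E →₀ V) :
    evalForm (fun p => θ p - η p) A = evalForm θ A - evalForm η A := by
  induction A using Finsupp.induction_linear with
  | zero => simp
  | add A B hA hB => rw [map_add, map_add, map_add, hA, hB]; abel
  | single p α => simp [evalForm_single]

theorem evalForm_congr {θ η : E → V →L[ℝ] F} {A : E →₀ V} (h : ∀ p ∈ A.support, θ p = η p) :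
    evalForm θ A = evalForm η A := by
  simp only [evalForm, Finsupp.lsum_apply, Finsupp.sum]
  exact Finset.sum_congr rfl fun p hp => by rw [h p hp]

theorem difference_single (u p : E) (α : V) :
    difference u (Finsupp.single p α) = Finsupp.single (p + u) α - Finsupp.single p α := by
  simp [difference, translate, Finsupp.mapDomain_single]

theorem evalForm_difference (θ : E → V →L[ℝ] F) (u : E) (A : E →₀ V) :
    evalForm θ (difference u A) = evalForm (fun p => θ (p + u) - θ p) A := by
  induction A using Finsupp.induction_linear with
  | zero => simp
  | add A B hA hB => simp only [map_add, hA, hB]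
  | single p α => simp [difference_single, evalForm_single]

/-- Differences of a chain pass to the form by duality. The outermost difference of the chain
becomes the innermost one of the form, which is the order in which `iteratedDiff` recurses. -/
theorem evalForm_chain (θ : E → V →L[ℝ] F) (D : DifferenceElement E V) :
    evalForm θ D.chain = iteratedDiff D.dirs θ D.pt D.vec := by
  obtain ⟨U, p, α⟩ := D
  unfold DifferenceElement.chain
  induction U generalizing θ with
  | nil => exact evalForm_single θ p α
  | cons u U ih =>
    rw [List.foldr_cons, evalForm_difference]
    exact ih _

theorem DiffBound.isBForm {r : ℕ} {θ : E → V →L[ℝ] F} {C : ℝ} (h : DiffBound r θ C) :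
    IsBForm r θ := by
  refine ⟨C, fun D hD => ?_⟩
  rw [evalForm_chain, DifferenceElement.weight, ← mul_assoc]
  exact (ContinuousLinearMap.le_opNorm _ _).trans
    (mul_le_mul_of_nonneg_right (h D.dirs hD D.pt) (norm_nonneg _))

theorem IsBForm.exists_diffBound {r : ℕ} {θ : E → V →L[ℝ] F} (h : IsBForm r θ) :
    ∃ C, DiffBound r θ C := by
  obtain ⟨C, hC⟩ := h
  -- `IsBForm` does not fix the sign of its constant, while an operator norm bound must be
  -- non-negative.
  refine ⟨|C|, fun U hU p => ContinuousLinearMap.opNorm_le_bound _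
    (mul_nonneg (abs_nonneg _) (prod_norm_nonneg U)) fun α => ?_⟩
  have := hC ⟨U, p, α⟩ hU
  rw [evalForm_chain] at this
  refine this.trans ((mul_le_mul_of_nonneg_right (le_abs_self C)
    (DifferenceElement.weight_nonneg _)).trans (le_of_eq ?_))
  simp only [DifferenceElement.weight]
  ring

theorem IsBForm.sub {r : ℕ} {θ η : E → V →L[ℝ] F} (hθ : IsBForm r θ) (hη : IsBForm r η) :
    IsBForm r fun p => θ p - η p := by
  obtain ⟨C, hC⟩ := hθ.exists_diffBound
  obtain ⟨D, hD⟩ := hη.exists_diffBound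
  exact (hC.sub hD).isBForm

/-- Unlike `IsBForm.bound`, this keeps the constant explicit, so that it can be used uniformly over
a sequence of forms. -/
theorem DiffBound.norm_evalForm_le {r : ℕ} {θ : E → V →L[ℝ] F} {C : ℝ} (h : DiffBound r θ C)
    (A : E →₀ V) : ‖evalForm θ A‖ ≤ C * rNorm r A := by
  have key : ∀ L : List (DifferenceElement E V), (∀ D ∈ L, D.dirs.length ≤ r) →
      ‖evalForm θ (L.map DifferenceElement.chain).sum‖ ≤
        C * (L.map DifferenceElement.weight).sum := by
    intro L hL
    induction L with
    | nil => simp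
    | cons D L ih =>
      rw [List.map_cons, List.sum_cons, map_add, List.map_cons, List.sum_cons, mul_add]
      refine (norm_add_le _ _).trans (add_le_add ?_
        (ih fun D hD => hL D (List.mem_cons_of_mem _ hD)))
      rw [evalForm_chain, DifferenceElement.weight, ← mul_assoc]
      exact (ContinuousLinearMap.le_opNorm _ _).trans (mul_le_mul_of_nonneg_right
        (h D.dirs (hL D List.mem_cons_self) D.pt) (norm_nonneg _))
  rcases h.nonneg.eq_or_lt with rfl | hC
  · obtain ⟨c, L, hL, rfl, -⟩ := weights_nonempty r A
    simpa using key L hL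
  · rw [← div_le_iff₀' hC]
    refine le_csInf (weights_nonempty r A) ?_
    rintro c ⟨L, hL, rfl, rfl⟩
    rw [div_le_iff₀' hC]
    exact key L hL

theorem denseRange_toChain (r : ℕ) : DenseRange (toChain r : (E →₀ V) → Chain E V r) :=
  UniformSpace.Completion.denseRange_coe (α := PointedChain E V r)

variable [CompleteSpace F] {r : ℕ}

theorem integral_toChain {θ : E → V →L[ℝ] F} (hθ : IsBForm r θ) (A : E →₀ V) :
    integral θ hθ (toChain r A) = evalForm θ A := extend_toChain _ _ A

theorem DiffBound.norm_integral_le {θ : E → V →L[ℝ] F} {C : ℝ} (h : DiffBound r θ C)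
    (hθ : IsBForm r θ) (J : Chain E V r) : ‖integral θ hθ J‖ ≤ C * ‖J‖ := by
  refine (denseRange_toChain r).induction_on (p := fun J => ‖integral θ hθ J‖ ≤ C * ‖J‖) J
    (isClosed_le (by fun_prop) (by fun_prop)) fun A => ?_
  rw [integral_toChain, norm_toChain]
  exact h.norm_evalForm_le A

theorem integral_sub {θ η : E → V →L[ℝ] F} (hθ : IsBForm r θ) (hη : IsBForm r η)
    (h : IsBForm r fun p => θ p - η p) (J : Chain E V r) :
    integral _ h J = integral θ hθ J - integral η hη J := by
  refine (denseRange_toChain r).induction_on (p := fun J =>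
    integral _ h J = integral θ hθ J - integral η hη J) J
    (isClosed_eq (by fun_prop) (by fun_prop)) fun A => ?_
  simp only [integral_toChain, evalForm_sub]

/-- A form vanishing on a non-empty open set containing a set that supports `J` has integral `0`. -/
theorem integral_eq_zero_of_supports {X W : Set E} {J : Chain E V r} (hX : Supports X J)
    (hne : W.Nonempty) (hW : IsOpen W) (hXW : X ⊆ W) {η : E → V →L[ℝ] F} (hη : IsBForm r η)
    (h0 : ∀ p ∈ W, η p = 0) : integral η hη J = 0 := by
  obtain ⟨A, hA, hlim⟩ := hX.2 W hne hW hXW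
  refine tendsto_nhds_unique (((integral η hη).continuous.tendsto J).comp hlim)
    (tendsto_const_nhds.congr fun i => ?_)
  rw [Function.comp_apply, integral_toChain,
    evalForm_congr (η := fun _ => 0) fun p hp => h0 p (hA i hp)]
  simp [evalForm, Finsupp.sum]

/-- If uniformly bounded forms agree with `η` eventually on every finite set and have integral `0`
over `J`, then so has `η`. -/
theorem integral_eq_zero_of_eventually_eq {J : Chain E V r} {η : E → V →L[ℝ] F}
    (hη : IsBForm r η) {θ : ℕ → E → V →L[ℝ] F} {C : ℝ} (hC : ∀ n, DiffBound r (θ n) C)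
    (h0 : ∀ n, integral (θ n) (hC n).isBForm J = 0) (h : ∀ p, ∀ᶠ n in atTop, θ n p = η p) :
    integral η hη J = 0 := by
  obtain ⟨D, hD⟩ := hη.exists_diffBound
  have hCn := (hC 0).nonneg
  have hDn := hD.nonneg
  rw [← norm_le_zero_iff]
  refine le_of_forall_pos_le_add fun ε hε => ?_
  obtain ⟨A, hA⟩ := (denseRange_toChain r).exists_dist_lt J
    (show 0 < ε / (C + D + 1) by positivity)
  rw [dist_eq_norm] at hA
  -- A pointed chain sees only finitely many points, so pointwise eventual agreement suffices.
  have hev : ∀ᶠ n in atTop, ∀ p ∈ A.support, θ n p = η p :=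
    (Filter.eventually_all_finset _).2 fun p _ => h p
  obtain ⟨n, hn⟩ := hev.exists
  -- The integrals over `A` cancel and that of `θ n` over `J` is `0`; what remains is at most `(C +
  -- D) ‖J - A‖`.
  have e : integral η hη J = integral η hη (J - toChain r A) -
      integral (θ n) (hC n).isBForm (J - toChain r A) := by
    rw [map_sub, map_sub, h0 n, integral_toChain, integral_toChain, evalForm_congr hn]
    abel
  have h1 := hD.norm_integral_le hη (J - toChain r A)
  have h2 := (hC n).norm_integral_le (hC n).isBForm (J - toChain r A)
  rw [lt_div_iff₀ (by positivity)] at hA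
  have h3 := norm_nonneg (J - toChain r A)
  rw [e, zero_add]
  refine (norm_sub_le _ _).trans ?_
  nlinarith

end Forms

/-! ## The integral depends only on the form near the support -/

section FormLemmas

open scoped ContDiff

theorem exists_smooth_cutoff {E : Type*} [NormedAddCommGroup E] [NormedSpace ℝ E]
    [FiniteDimensional ℝ E] {K U : Set E} (hK : IsCompact K) (hU : IsOpen U) (hKU : K ⊆ U) :
    ∃ χ : E → ℝ, ContDiff ℝ ∞ χ ∧ HasCompactSupport χ ∧ tsupport χ ⊆ U ∧
      ∃ W, IsOpen W ∧ K ⊆ W ∧ ∀ x ∈ W, χ x = 1 := by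
  obtain ⟨t, ht, hKt, htU⟩ := exists_compact_between hK hU hKU
  obtain ⟨f, h1, h0, -⟩ := exists_contMDiffMap_one_nhds_of_subset_interior (n := (⊤ : ℕ∞))
    (modelWithCornersSelf ℝ E) hK.isClosed hKt
  have hsupp : tsupport f ⊆ t := closure_minimal (fun x hx => by
    by_contra hxt
    exact hx (h0 x hxt)) ht.isClosed
  obtain ⟨W, hW, hKW, h⟩ := mem_nhdsSet_iff_exists.1 h1
  exact ⟨f, f.contMDiff.contDiff, HasCompactSupport.intro ht h0, hsupp.trans htU, W, hW, hKW, h⟩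

variable {E V F : Type*} [NormedAddCommGroup E] [NormedSpace ℝ E]
  [NormedAddCommGroup V] [NormedSpace ℝ V] [NormedAddCommGroup F] [NormedSpace ℝ F]
  [CompleteSpace F] {r : ℕ}

theorem integral_congr {θ η : E → V →L[ℝ] F} (h : ∀ p, θ p = η p) (hθ : IsBForm r θ)
    (hη : IsBForm r η) (J : Chain E V r) : integral θ hθ J = integral η hη J := by
  obtain rfl := funext h
  rfl

theorem integral_eq_zero {θ : E → V →L[ℝ] F} (h : ∀ p, θ p = 0) (hθ : IsBForm r θ)
    (J : Chain E V r) : integral θ hθ J = 0 := by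
  obtain rfl : θ = fun _ => 0 := funext h
  have := (DiffBound.const (E := E) r (0 : V →L[ℝ] F)).norm_integral_le hθ J
  simpa using this

theorem IsBForm.smul {χ : E → ℝ} {a : ℝ} (hχ : DiffBound r χ a) {η : E → V →L[ℝ] F}
    (hη : IsBForm r η) : IsBForm r fun p => χ p • η p := by
  obtain ⟨b, hb⟩ := hη.exists_diffBound
  exact (hχ.smul hb).isBForm

end FormLemmas

section Locality

open scoped ContDiff

variable {E : Type} {V F : Type*} [NormedAddCommGroup E] [NormedSpace ℝ E]
  [FiniteDimensional ℝ E] [Nontrivial E]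
  [NormedAddCommGroup V] [NormedSpace ℝ V] [NormedAddCommGroup F] [NormedSpace ℝ F]
  [CompleteSpace F] {r : ℕ}

/-- A compact set disjoint from the support of `J` can be cut out of every form without changing
the integral over `J`. -/
theorem exists_cutout (J : Chain E V r) {S : Set E} (hS : IsCompact S) (hSJ : Disjoint S (supp J)) :
    ∃ (ψ : E → ℝ) (a : ℝ) (hψ : DiffBound r ψ a), (∀ x ∈ S, ψ x = 0) ∧
      ∀ (η : E → V →L[ℝ] F) (hη : IsBForm r η),
        integral _ (hη.smul hψ) J = integral η hη J := by
  have hnc : NoncompactSpace E := NormedSpace.noncompactSpace ℝ E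
  -- Compactness reduces the claim to neighbourhoods of single points, since a union is cut out by
  -- the product of two cutoffs.
  refine hS.induction_on (p := fun S => ∃ (ψ : E → ℝ) (a : ℝ) (hψ : DiffBound r ψ a),
    (∀ x ∈ S, ψ x = 0) ∧ ∀ (η : E → V →L[ℝ] F) (hη : IsBForm r η),
      integral _ (hη.smul hψ) J = integral η hη J) ?_ ?_ ?_ ?_
  · exact ⟨_, _, DiffBound.const r (1 : ℝ), by simp,
      fun η hη => integral_congr (fun p => one_smul _ _) _ _ J⟩
  · rintro s t hst ⟨ψ, a, hψ, h0, h⟩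
    exact ⟨ψ, a, hψ, fun x hx => h0 x (hst hx), h⟩
  · rintro s t ⟨ψ, a, hψ, h0, h⟩ ⟨φ, b, hφ, k0, k⟩
    refine ⟨_, _, hψ.smul hφ, ?_, fun η hη => ?_⟩
    · rintro x (hx | hx)
      · simp [h0 x hx]
      · simp [k0 x hx]
    · rw [← k η hη, ← h _ (hη.smul hφ)]
      exact integral_congr (fun p => smul_assoc _ _ _) _ _ J
  · intro x hx
    -- The supporting set `X` depends on the point `x`.
    obtain ⟨X, hX, hxX⟩ : ∃ X, Supports X J ∧ x ∉ X := by
      simpa [supp] using hSJ.notMem_of_mem_left hx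
    obtain ⟨χ, hχ, hχc, hχX, W, hW, hxW, h1⟩ := exists_smooth_cutoff isCompact_singleton
      hX.1.isOpen_compl (singleton_subset_iff.2 hxX)
    obtain ⟨a, ha⟩ := exists_diffBound r hχ hχc
    refine ⟨W, mem_nhdsWithin_of_mem_nhds (hW.mem_nhds (hxW rfl)), _, _,
      (DiffBound.const r (1 : ℝ)).sub ha, fun y hy => by simp [h1 y hy], fun η hη => ?_⟩
    have hψη := hη.smul ((DiffBound.const r (1 : ℝ)).sub ha)
    -- With `ψ = 1 - χ`, the difference `η - ψη = χη` vanishes off `tsupport χ`, on an open set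
    -- containing `X`. That set is non-empty, as `Supports` demands, because `E` is not compact.
    have := integral_eq_zero_of_supports hX
      (nonempty_compl.2 fun h => noncompact_univ E (h ▸ hχc)) (isClosed_tsupport χ).isOpen_compl
      (subset_compl_comm.1 hχX) (hη.sub hψη) fun p hp => by
        simp [image_eq_zero_of_notMem_tsupport hp]
    rw [integral_sub hη hψη, sub_eq_zero] at this
    exact this.symm

/-- A form of class `ℬ^r` vanishing near the support of `J` has integral `0` over `J`. -/
theorem integral_eq_zero_of_eqOn_supp {J : Chain E V r} {η : E → V →L[ℝ] F} (hη : IsBForm r η)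
    {U : Set E} (hU : IsOpen U) (hJU : supp J ⊆ U) (h0 : ∀ p ∈ U, η p = 0) :
    integral η hη J = 0 := by
  -- A bump equal to `1` near the origin: its dilates `χ (p / (n + 1))` are compactly supported and
  -- eventually equal `1` at each point.
  obtain ⟨χ, hχ, hχc, -, W, hW, h0W, h1⟩ :=
    exists_smooth_cutoff (isCompact_singleton (x := (0 : E))) isOpen_univ (subset_univ _)
  obtain ⟨a, ha⟩ := exists_diffBound r hχ hχc
  obtain ⟨b, hb⟩ := hη.exists_diffBound
  have hc : ∀ n : ℕ, |((n : ℝ) + 1)⁻¹| ≤ 1 := fun n => by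
    rw [abs_of_pos (by positivity)]
    exact inv_le_one_of_one_le₀ (by linarith [n.cast_nonneg (α := ℝ)])
  refine integral_eq_zero_of_eventually_eq hη
    (θ := fun n p => χ (((n : ℝ) + 1)⁻¹ • p) • η p)
    (fun n => (ha.comp_smul (hc n)).smul hb) (fun n => ?_) fun p => ?_
  -- Only on this compact set, which misses `supp J`, can the truncated form be non-zero; cutting it
  -- out leaves the zero form.
  · have hS : IsCompact (tsupport (fun p => χ (((n : ℝ) + 1)⁻¹ • p)) ∩ Uᶜ) :=
      IsCompact.inter_right (hχc.comp_smul (c := ((n : ℝ) + 1)⁻¹) (by positivity)) hU.isClosed_compl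
    obtain ⟨ψ, c, hψ, hψ0, h⟩ := exists_cutout (F := F) J hS
      (disjoint_left.2 fun x hx hxJ => hx.2 (hJU hxJ))
    rw [← h _ ((ha.comp_smul (hc n)).smul hb).isBForm]
    refine integral_eq_zero (fun p => ?_) _ J
    by_cases hpU : p ∈ U
    · simp [h0 p hpU]
    by_cases hp : p ∈ tsupport (fun p => χ (((n : ℝ) + 1)⁻¹ • p))
    · simp [hψ0 p ⟨hp, hpU⟩]
    · have := image_eq_zero_of_notMem_tsupport hp
      simp [this]
  · have hlim : Tendsto (fun n : ℕ => ((n : ℝ) + 1)⁻¹ • p) atTop (𝓝 0) := by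
      have := (tendsto_one_div_add_atTop_nhds_zero_nat (𝕜 := ℝ)).smul_const p
      simpa using this
    filter_upwards [hlim.eventually (hW.mem_nhds (h0W rfl))] with n hn
    rw [h1 _ hn, one_smul]

theorem IsLocalIntegral.unique {J : Chain E V r} {θ : E → V →L[ℝ] F} {c d : F}
    (hc : IsLocalIntegral J θ c) (hd : IsLocalIntegral J θ d) : c = d := by
  obtain ⟨U, η, hη, hU, hJU, h, rfl⟩ := hc
  obtain ⟨U', η', hη', hU', hJU', h', rfl⟩ := hd
  rw [← sub_eq_zero, ← integral_sub hη hη' (hη.sub hη')]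
  exact integral_eq_zero_of_eqOn_supp _ (hU.inter hU') (subset_inter hJU hJU') fun p hp => by
    rw [h hp.1, h' hp.2, sub_self]

theorem IsLocalIntegral.locallyIntegrable {J : Chain E V r} {θ : E → V →L[ℝ] F} {c : F}
    (hc : IsLocalIntegral J θ c) : LocallyIntegrable J θ :=
  ⟨c, hc, fun _ hd => hd.unique hc⟩

theorem IsLocalIntegral.localIntegral_eq {J : Chain E V r} {θ : E → V →L[ℝ] F} {c : F}
    (hc : IsLocalIntegral J θ c) : localIntegral J θ = c := by
  have h := hc.locallyIntegrable
  rw [localIntegral, dif_pos h]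
  exact h.choose_spec.1.unique hc

theorem IsLocalIntegral.sub {J : Chain E V r} {θ θ' : E → V →L[ℝ] F} {c d : F}
    (hc : IsLocalIntegral J θ c) (hd : IsLocalIntegral J θ' d) :
    IsLocalIntegral J (fun p => θ p - θ' p) (c - d) := by
  obtain ⟨U, η, hη, hU, hJU, h, rfl⟩ := hc
  obtain ⟨U', η', hη', hU', hJU', h', rfl⟩ := hd
  refine ⟨U ∩ U', _, hη.sub hη', hU.inter hU', subset_inter hJU hJU', fun p hp => ?_,
    integral_sub hη hη' _ J⟩
  simp only [h hp.1, h' hp.2]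

end Locality

/-! ### Forms that are smooth near a compact support -/

section SmoothForms

open scoped ContDiff

variable {E : Type} {V G : Type} [NormedAddCommGroup E] [NormedSpace ℝ E]
  [FiniteDimensional ℝ E]
  [NormedAddCommGroup V] [NormedSpace ℝ V] [NormedAddCommGroup G] [NormedSpace ℝ G]
  {r : ℕ}

/-- A function that is smooth near a compact set agrees near this set with a smooth compactly
supported function. -/
theorem exists_smooth_extension {K U : Set E} (hK : IsCompact K) (hU : IsOpen U) (hKU : K ⊆ U)
    {f : E → G} (hf : ∀ p ∈ U, ContDiffAt ℝ ∞ f p) :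
    ∃ g : E → G, ContDiff ℝ ∞ g ∧ HasCompactSupport g ∧
      ∃ W, IsOpen W ∧ K ⊆ W ∧ W ⊆ U ∧ EqOn g f W := by
  obtain ⟨χ, hχ, hχc, hχU, W, hW, hKW, h1⟩ := exists_smooth_cutoff hK hU hKU
  refine ⟨fun p => χ p • f p, contDiff_iff_contDiffAt.2 fun p => ?_, hχc.smul_right, W ∩ U,
    hW.inter hU, subset_inter hKW hKU, inter_subset_right, fun p hp => ?_⟩
  -- Off `tsupport χ` the product is locally `0`, whatever `f` does there.
  · by_cases hp : p ∈ tsupport χ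
    · exact hχ.contDiffAt.smul (hf p (hχU hp))
    · have h := notMem_tsupport_iff_eventuallyEq.1 hp
      refine contDiffAt_const (c := (0 : G)) |>.congr_of_eventuallyEq ?_
      filter_upwards [h] with q hq
      simp [hq]
  · simp [h1 p hp.1]

/-- Compactness of the support lets the global extension be compactly supported, which puts it in
every class `ℬ^r`. -/
theorem exists_isLocalIntegral [CompleteSpace G] {J : Chain E V r} (hJ : IsCompact (supp J))
    {U : Set E} (hU : IsOpen U) (hJU : supp J ⊆ U) {θ : E → V →L[ℝ] G}
    (hθ : ∀ p ∈ U, ContDiffAt ℝ ∞ θ p) : ∃ c, IsLocalIntegral J θ c := by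
  obtain ⟨η, hη, hηc, W, hW, hJW, -, h⟩ := exists_smooth_extension hJ hU hJU hθ
  obtain ⟨C, hC⟩ := exists_diffBound r hη hηc
  exact ⟨_, W, η, hC.isBForm, hW, hJW, h, rfl⟩

end SmoothForms

/-! ## Exact forms -/

section Exact

open scoped ContDiff

variable {G : Type} [NormedAddCommGroup G] [NormedSpace ℝ G] [CompleteSpace G] {r : ℕ}

/-- The `G`-valued `0`-form given by a function. -/
def zeroForm {E : Type*} (g : E → G) (p : E) : ℝ →L[ℝ] G :=
  (1 : ℝ →L[ℝ] ℝ).smulRight (g p)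

/-- Stokes' theorem for the differential of a smooth function. -/
theorem integral_boundary (hr : 1 ≤ r) {g : ℂ → G} (hg : Differentiable ℝ g)
    (h0 : IsBForm (r + 1) (zeroForm g)) (h1 : IsBForm r (fderiv ℝ g)) (J : Chain ℂ ℂ r) :
    integral _ h0 (boundary r hr J) = integral _ h1 J := by
  -- Integrating `g` over the difference quotients gives the slopes of `g` along `v`, so the limit
  -- is a directional derivative.
  have hP : ∀ (v p : ℂ) (t : ℝ), integral _ h0 (prederivPointed r v (Finsupp.single p t)) =
      t • fderiv ℝ g p v := by
    intro v p t
    refine tendsto_nhds_unique (((integral _ h0).continuous.tendsto _).comp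
      (tendsto_prederivPointed hr v (Finsupp.single p t))) ?_
    have hd := ((hg p).hasFDerivAt.hasLineDerivAt v)
    have := (hasDerivAt_iff_tendsto_slope_zero.1 hd).const_smul t
    refine this.congr fun s => ?_
    simp only [Function.comp_apply, quotient, integral_toChain, evalForm_difference,
      Finsupp.smul_single, evalForm_single, zeroForm]
    simp [smul_sub, smul_smul, mul_comm]
  refine (denseRange_toChain r).induction_on (p := fun J =>
    integral _ h0 (boundary r hr J) = integral _ h1 J) J
    (isClosed_eq (by fun_prop) (by fun_prop)) fun A => ?_
  induction A using Finsupp.induction_linear with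
  | zero => simp
  | add A B hA hB => simp only [map_add, hA, hB]
  | single p α =>
    rw [integral_toChain, evalForm_single]
    have hR : ∀ v : ℂ, prederiv r hr v (retraction r v (toChain r (Finsupp.single p α))) =
        prederivPointed r v (Finsupp.single p (inner ℝ v α)) := by
      intro v
      rw [retraction, extend_toChain, LinearMap.comp_apply, prederiv, extend_toChain]
      simp [prederivLinear, mapFibre]
    simp only [boundary, sum_apply, ContinuousLinearMap.comp_apply, map_sum,
      hR, hP]
    -- Expanding `α` in the orthonormal basis turns `dg(α)` into the sum of `⟨eᵢ, α⟩ dg(eᵢ)`.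
    conv_rhs => rw [← Complex.orthonormalBasisOneI.sum_repr' α]
    simp only [map_sum, map_smul]

/-- An exact form with a primitive near the support of a closed compactly supported chain has
integral `0`. -/
theorem isLocalIntegral_zero_of_hasFDerivAt (hr : 1 ≤ r) {J : Chain ℂ ℂ r}
    (hclosed : IsClosedChain hr J) (hJ : IsCompact (supp J)) {U : Set ℂ} (hU : IsOpen U)
    (hJU : supp J ⊆ U) {f : ℂ → G} (hf : ∀ p ∈ U, ContDiffAt ℝ ∞ f p) {θ : ℂ → ℂ →L[ℝ] G}
    (hθ : ∀ p ∈ U, HasFDerivAt f (θ p) p) : IsLocalIntegral J θ 0 := by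
  obtain ⟨g, hg, hgc, W, hW, hJW, hWU, h⟩ := exists_smooth_extension hJ hU hJU hf
  obtain ⟨C, hC⟩ := exists_diffBound r (hg.fderiv_right (m := ∞) (by simp))
    (hgc.fderiv (𝕜 := ℝ))
  have hz : HasCompactSupport (zeroForm g) := hgc.mono fun p hp hgp => hp (by
    ext
    simp [zeroForm, hgp])
  obtain ⟨D, hD⟩ := exists_diffBound (r + 1)
    (show ContDiff ℝ ∞ (zeroForm g) from contDiff_const.smulRight hg) hz
  -- The global form is `dg`. It needs class `r`, while `g` itself needs class `r + 1`, the order of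
  -- the boundary of `J`.
  refine ⟨W, _, hC.isBForm, hW, hJW, fun p hp => ?_, ?_⟩
  · rw [(h.eventuallyEq_of_mem (hW.mem_nhds hp)).fderiv_eq, (hθ p (hWU hp)).fderiv]
  · rw [← integral_boundary hr (hg.differentiable (by simp)) hD.isBForm, hclosed, map_zero]

end Exact

/-! ## Winding numbers -/

section Winding

open scoped ContDiff

variable {r : ℕ}

theorem isClosed_supp {E V : Type*} [NormedAddCommGroup E] [NormedSpace ℝ E]
    [NormedAddCommGroup V] [NormedSpace ℝ V] (J : Chain E V r) : IsClosed (supp J) :=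
  isClosed_sInter fun _ hX => hX.1

theorem exists_isLocalIntegral_cauchyForm {J : Chain ℂ ℂ r} (hJ : IsCompact (supp J)) {z : ℂ}
    (hz : z ∉ supp J) : ∃ c, IsLocalIntegral J (cauchyForm z) c := by
  refine exists_isLocalIntegral hJ (isOpen_compl_singleton (x := z))
    (subset_compl_singleton_iff.2 hz) fun p hp => ?_
  exact ((contDiffAt_id.sub contDiffAt_const).inv (sub_ne_zero.2 hp)).smul contDiffAt_const

/-- The form `dw/(w - a) - dw/(w - b)` has the primitive `log ((w - a) / (w - b))`. -/
theorem isLocalIntegral_cauchyForm_sub (hr : 1 ≤ r) {J : Chain ℂ ℂ r}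
    (hclosed : IsClosedChain hr J) (hJ : IsCompact (supp J)) {a b : ℂ}
    (h : ∀ w ∈ supp J, ‖a - b‖ < ‖w - b‖) :
    IsLocalIntegral J (fun w => cauchyForm a w - cauchyForm b w) 0 := by
  have hU : IsOpen {w : ℂ | ‖a - b‖ < ‖w - b‖} := isOpen_lt (by fun_prop) (by fun_prop)
  have hb : ∀ w : ℂ, ‖a - b‖ < ‖w - b‖ → w - b ≠ 0 := fun w hw =>
    norm_pos_iff.1 ((norm_nonneg _).trans_lt hw)
  have ha : ∀ w : ℂ, ‖a - b‖ < ‖w - b‖ → w - a ≠ 0 := fun w hw h0 => by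
    rw [sub_eq_zero.1 h0] at hw
    exact lt_irrefl _ hw
  have hslit : ∀ w : ℂ, ‖a - b‖ < ‖w - b‖ → (w - a) / (w - b) ∈ Complex.slitPlane := by
    intro w hw
    -- The correction to `1` has norm less than `1`, which keeps the quotient off the branch cut.
    have : (w - a) / (w - b) = 1 + -((a - b) / (w - b)) := by
      field_simp [hb w hw]
      ring
    rw [this]
    refine Complex.mem_slitPlane_of_norm_lt_one ?_
    rw [norm_neg, norm_div, div_lt_one (norm_pos_iff.2 (hb w hw))]
    exact hw
  refine isLocalIntegral_zero_of_hasFDerivAt hr hclosed hJ hU h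
    (f := fun w => Complex.log ((w - a) / (w - b))) (fun w hw => ?_) fun w hw => ?_
  · have h1 : ContDiffAt ℂ ∞ (fun w : ℂ => (w - a) / (w - b)) w :=
      (contDiffAt_id.sub contDiffAt_const).div (contDiffAt_id.sub contDiffAt_const) (hb w hw)
    exact ((Complex.contDiffAt_log (hslit w hw)).comp w h1).restrict_scalars ℝ
  · have h1 := ((((hasDerivAt_id w).sub_const a).div ((hasDerivAt_id w).sub_const b)
      (hb w hw)).clog (hslit w hw)).complexToReal_fderiv
    refine h1.congr_fderiv (ContinuousLinearMap.ext fun v => ?_)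
    have := ha w hw
    have := hb w hw
    simp only [cauchyForm, Pi.div_apply, smul_apply,
      sub_apply, one_apply_eq_self, ContinuousLinearMap.id_apply,
      smul_eq_mul, id]
    field_simp

/-- Far from the support, `dw/(w - z)` has the primitive `log (1 - w / z)`. -/
theorem isLocalIntegral_cauchyForm_zero (hr : 1 ≤ r) {J : Chain ℂ ℂ r}
    (hclosed : IsClosedChain hr J) (hJ : IsCompact (supp J)) {z : ℂ}
    (h : ∀ w ∈ supp J, ‖w‖ < ‖z‖) : IsLocalIntegral J (cauchyForm z) 0 := by
  have hU : IsOpen {w : ℂ | ‖w‖ < ‖z‖} := isOpen_lt (by fun_prop) (by fun_prop)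
  have hz : ∀ w : ℂ, ‖w‖ < ‖z‖ → z ≠ 0 := fun w hw =>
    norm_pos_iff.1 ((norm_nonneg _).trans_lt hw)
  have hwz : ∀ w : ℂ, ‖w‖ < ‖z‖ → w - z ≠ 0 := fun w hw h0 => by
    rw [sub_eq_zero.1 h0] at hw
    exact lt_irrefl _ hw
  have hslit : ∀ w : ℂ, ‖w‖ < ‖z‖ → (w - z) / (-z) ∈ Complex.slitPlane := by
    intro w hw
    have : (w - z) / (-z) = 1 + -(w / z) := by
      field_simp [hz w hw]
      ring
    rw [this]
    refine Complex.mem_slitPlane_of_norm_lt_one ?_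
    rw [norm_neg, norm_div, div_lt_one (norm_pos_iff.2 (hz w hw))]
    exact hw
  refine isLocalIntegral_zero_of_hasFDerivAt hr hclosed hJ hU h
    (f := fun w => Complex.log ((w - z) / (-z))) (fun w hw => ?_) fun w hw => ?_
  · have h1 : ContDiffAt ℂ ∞ (fun w : ℂ => (w - z) / (-z)) w :=
      (contDiffAt_id.sub contDiffAt_const).div_const _
    exact ((Complex.contDiffAt_log (hslit w hw)).comp w h1).restrict_scalars ℝ
  · have h1 := ((((hasDerivAt_id w).sub_const z).div_const (-z)).clog
      (hslit w hw)).complexToReal_fderiv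
    refine h1.congr_fderiv (ContinuousLinearMap.ext fun v => ?_)
    have := hz w hw
    have := hwz w hw
    simp only [cauchyForm, smul_apply, one_apply_eq_self,
      ContinuousLinearMap.id_apply, smul_eq_mul, id]
    field_simp

theorem windingNumber_eq_of_lt (hr : 1 ≤ r) {J : Chain ℂ ℂ r}
    (hclosed : IsClosedChain hr J) (hJ : IsCompact (supp J)) {a b : ℂ} (ha : a ∉ supp J)
    (hb : b ∉ supp J) (h : ∀ w ∈ supp J, ‖a - b‖ < ‖w - b‖) :
    windingNumber J a = windingNumber J b := by
  obtain ⟨c, hc⟩ := exists_isLocalIntegral_cauchyForm hJ ha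
  obtain ⟨d, hd⟩ := exists_isLocalIntegral_cauchyForm hJ hb
  have := (hc.sub hd).unique (isLocalIntegral_cauchyForm_sub hr hclosed hJ h)
  rw [windingNumber, windingNumber, hc.localIntegral_eq, hd.localIntegral_eq, sub_eq_zero.1 this]

/-- The winding number of a closed compactly supported chain is locally constant off the
support. -/
theorem eventually_windingNumber_eq (hr : 1 ≤ r) {J : Chain ℂ ℂ r}
    (hclosed : IsClosedChain hr J) (hJ : IsCompact (supp J)) {b : ℂ} (hb : b ∉ supp J) :
    ∀ᶠ a in 𝓝 b, windingNumber J a = windingNumber J b := by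
  obtain ⟨ε, hε, hball⟩ := Metric.isOpen_iff.1 (isClosed_supp J).isOpen_compl b hb
  filter_upwards [Metric.ball_mem_nhds b hε] with a ha
  refine windingNumber_eq_of_lt hr hclosed hJ (hball ha) hb fun w hw => ?_
  rw [mem_ball_iff_norm] at ha
  refine ha.trans_le (le_of_not_gt fun hlt => hball (mem_ball_iff_norm.2 hlt) hw)

theorem windingNumber_eq_of_mem_connectedComponentIn (hr : 1 ≤ r) {J : Chain ℂ ℂ r}
    (hclosed : IsClosedChain hr J) (hJ : IsCompact (supp J)) {a b : ℂ}
    (ha : a ∈ connectedComponentIn (supp J)ᶜ b) (hb : b ∉ supp J) :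
    windingNumber J a = windingNumber J b := by
  -- Having equal winding numbers is an equivalence relation with a neighbourhood of each point in
  -- one class, so a preconnected set lies in a single class.
  refine isPreconnected_connectedComponentIn.induction₂ (x := a) (y := b)
    (fun x y => windingNumber J x = windingNumber J y) (fun x hx => ?_)
    (fun x y z _ _ _ => Eq.trans) (fun x y _ _ => Eq.symm) ha (mem_connectedComponentIn hb)
  refine mem_nhdsWithin_of_mem_nhds ?_
  filter_upwards [eventually_windingNumber_eq hr hclosed hJ
    (connectedComponentIn_subset _ _ hx)] with y hy
  exact hy.symm

end Winding

end DiffChain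

theorem mainTheorem5 (r : ℕ) (hr : 1 ≤ r) (J : DiffChain.Chain ℂ ℂ r)
    (hclosed : DiffChain.IsClosedChain hr J) (hcompact : IsCompact (DiffChain.supp J))
    (z : ℂ) (hz : z ∈ (DiffChain.supp J)ᶜ)
    (hunbounded : ¬ Bornology.IsBounded (connectedComponentIn (DiffChain.supp J)ᶜ z)) :
    DiffChain.LocallyIntegrable J (DiffChain.cauchyForm z) ∧
      DiffChain.windingNumber J z = 0 := by
  obtain ⟨c, hc⟩ := DiffChain.exists_isLocalIntegral_cauchyForm hcompact hz
  refine ⟨hc.locallyIntegrable, ?_⟩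
  obtain ⟨R, hR⟩ := hcompact.isBounded.exists_norm_le
  -- The component leaves the disc of radius `R` containing `supp J`, so the winding number can be
  -- computed at a far point `a`.
  obtain ⟨a, ha, haR⟩ : ∃ a ∈ connectedComponentIn (DiffChain.supp J)ᶜ z, R < ‖a‖ := by
    by_contra! h
    exact hunbounded (isBounded_iff_forall_norm_le.2 ⟨R, h⟩)
  rw [← DiffChain.windingNumber_eq_of_mem_connectedComponentIn hr hclosed hcompact ha hz,
    DiffChain.windingNumber, (DiffChain.isLocalIntegral_cauchyForm_zero hr hclosed hcompact
      fun w hw => (hR w hw).trans_lt haR).localIntegral_eq, mul_zero]
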